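/- All graphs are finite, connected, and without loops or multiple edges. An Eulerian circuit of a graph is a closed walk that traverses each edge exactly once. Two Eulerian circuits $C_1 = u, v_1, \ldots, v_{m-1}, u$ and $C_2 = u, w_1, \ldots, w_{m-1}, u$ of a graph with $m$ edges, both starting and ending at the vertex $u$, are \emph{avoiding} if, for every $1 \le i \le m-1$, $v_i \neq w_i$ and $v_i$ is not adjacent to $w_i$. A graph is \emph{doubly Eulerian} if for every vertex $u$ it admits a pair of avoiding Eulerian circuits starting and ending at $u$. A doubly Eulerian graph of order $n$ is \emph{edge-maximal} if no doubly Eulerian graph of order $n$ has more edges. A \emph{circulant graph} of order $n$ is a graph with vertex set $\mathbb{Z}_n$ for which there is a set $S \subseteq \mathbb{Z}_n$ such that distinct vertices $x, y$ are adjacent if and only if $x - y \in S$ or $y - x \in S$. \textbf{Theorem.} For every odd $n \ge 9$ there exists an edge-maximal doubly Eulerian graph of order $n$ which is regular of degree $n-3$ and is a circulant graph. -/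

import Mathlib

/-- Two closed walks from `u` of the same length are avoiding if at every step other than the
first and the last one their current vertices are neither equal nor adjacent. -/
def SimpleGraph.Walk.IsAvoiding {V : Type*} {G : SimpleGraph V} {u : V}
    (p q : G.Walk u u) : Prop :=
  p.length = q.length ∧
    ∀ i : ℕ, 0 < i → i < p.length →
      p.getVert i ≠ q.getVert i ∧ ¬ G.Adj (p.getVert i) (q.getVert i)

/-- A connected graph is doubly Eulerian if from every vertex there start two avoiding
Eulerian circuits. -/
def SimpleGraph.IsDoublyEulerian {V : Type*} [DecidableEq V] (G : SimpleGraph V) : Prop :=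
  G.Connected ∧
    ∀ u : V, ∃ p q : G.Walk u u, p.IsEulerian ∧ q.IsEulerian ∧ p.IsAvoiding q

open Classical in
/-- A finite graph is an edge-maximal doubly Eulerian graph if it is doubly Eulerian and no doubly
Eulerian graph of the same order has more edges. Up to isomorphism every graph of that order
lives on the same vertex set. -/
def SimpleGraph.IsEdgeMaximalDoublyEulerian {V : Type*} [Fintype V] (G : SimpleGraph V) : Prop :=
  G.IsDoublyEulerian ∧
    ∀ H : SimpleGraph V, H.IsDoublyEulerian → H.edgeFinset.card ≤ G.edgeFinset.card

/-!
On an odd number `n` of vertices, a doubly Eulerian graph has even degrees, and no vertex of degree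
`n - 1`: while one circuit visits such a vertex, the other has nowhere to be. So all degrees are at
most `n - 3` (`IsDoublyEulerian.degree_le`), and a doubly Eulerian graph that is regular of degree
`n - 3` is edge-maximal. The graph used is the complement of the cycle on `ZMod n` (`coCycle`), where
two vertices are equal or adjacent unless they differ by `±1`. By translation it is enough to find
avoiding Eulerian circuits `p` and `q` from `0`.

If `q` were the translate `p + 1`, it would stay apart from `p`, but it would start at `1`. The
repair is made on a short closed trail, `W = 0, -3, 2, 4, 6, …, -1, 2, 0` (`evenTour`). The closed
walk `W' = 0, -2, 1, 3, 5, …, -2, 3, 0` keeps next to it, one step ahead at `-3` and at the second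
visit to `2`, and one step behind along `2, 4, …, -1`. The edges of both `W'` and the
translate `W + 1` are `{1, 3}, {3, 5}, …, {-2, 0}`, `{0, 3}`, `{3, -2}` and `{-2, 1}`, in different
orders. `W` uses only vertices with even representatives in `[0, n)`;
hence deleting its edges leaves a connected graph with even degrees, which by Euler's theorem
(`Connected.exists_isEulerian`) has an Eulerian circuit `T` from `2`. Inserting `T` in `W`, and
`T + 1` in `W'`, just before the return to `0`, gives the circuits `p` and `q`; the edges of `q` are
those of `p + 1` in another order (`exists_avoiding_isEulerian_coCycle`).
-/

/-! ### Eulerian circuits of connected graphs with even degrees -/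

namespace SimpleGraph

variable {V : Type*} {G : SimpleGraph V}

theorem Walk.IsTrail.card_filter_mem_edgesFinset [DecidableEq V] {u v : V} {p : G.Walk u v}
    (hp : p.IsTrail) (x : V) :
    (hp.edgesFinset.filter (x ∈ ·)).card = p.edges.countP fun e => x ∈ e := by
  rw [← Multiset.coe_countP, Multiset.countP_eq_card_filter]
  rfl

/-- Deleting the edges of a closed trail changes every degree by an even number. -/
theorem Walk.IsTrail.even_degree_deleteEdges [Fintype V] [DecidableEq V]
    [DecidableRel G.Adj] {u : V} {p : G.Walk u u} (hp : p.IsTrail)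
    [DecidableRel (G.deleteEdges {e | e ∈ p.edges}).Adj]
    {x : V} (hx : Even (G.degree x)) :
    Even ((G.deleteEdges {e | e ∈ p.edges}).degree x) := by
  have hsub : hp.edgesFinset.filter (x ∈ ·) ⊆ G.incidenceFinset x := by
    intro e he
    simp only [Finset.mem_filter] at he
    rw [incidenceFinset_eq_filter, Finset.mem_filter, mem_edgeFinset]
    exact ⟨p.edges_subset_edgeSet he.1, he.2⟩
  have hsd : (G.deleteEdges {e | e ∈ p.edges}).incidenceFinset x =
      G.incidenceFinset x \ hp.edgesFinset.filter (x ∈ ·) := by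
    ext e
    simp only [incidenceFinset_eq_filter, Finset.mem_filter, mem_edgeFinset, edgeSet_deleteEdges,
      Set.mem_sdiff, Set.mem_ofPred_eq, Finset.mem_sdiff]
    tauto
  rw [← card_incidenceFinset_eq_degree, hsd, Finset.card_sdiff_of_subset hsub,
    card_incidenceFinset_eq_degree, hp.card_filter_mem_edgesFinset]
  exact hx.tsub ((hp.even_countP_edges_iff x).2 fun h => (h rfl).elim)

/-- A trail that is not closed leaves out an edge at its last vertex, if that vertex has even
degree: it uses an odd number of the edges there. -/
theorem Walk.IsTrail.exists_adj_notMem_edges [Fintype V] [DecidableEq V] [DecidableRel G.Adj]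
    {u v : V} {p : G.Walk u v} (hp : p.IsTrail) (huv : u ≠ v) (hv : Even (G.degree v)) :
    ∃ w, G.Adj v w ∧ s(v, w) ∉ p.edges := by
  by_contra! hall
  have hinc : G.incidenceFinset v = hp.edgesFinset.filter (v ∈ ·) := by
    ext e
    simp only [incidenceFinset_eq_filter, Finset.mem_filter, mem_edgeFinset,
]
    refine and_congr_left fun hve => ⟨fun he => ?_, fun he => p.edges_subset_edgeSet he⟩
    obtain ⟨w, rfl⟩ := Sym2.mem_iff_exists.1 hve
    exact hall w he
  rw [← card_incidenceFinset_eq_degree, hinc, hp.card_filter_mem_edgesFinset,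
    hp.even_countP_edges_iff] at hv
  exact (hv huv).2 rfl

/-- **Euler's theorem**: a finite connected graph whose degrees are even has an Eulerian circuit
from every vertex. A longest trail is one. By parity it is closed, since otherwise it could be
prolonged; and if it missed an edge, then by connectedness it would miss one at a vertex on it,
and could be prolonged by that edge when started there. -/
theorem Connected.exists_isEulerian [Fintype V] [DecidableEq V] [DecidableRel G.Adj]
    (hG : G.Connected) (heven : ∀ x, Even (G.degree x)) (v : V) :
    ∃ p : G.Walk v v, p.IsEulerian := by
  have : Nonempty V := ⟨v⟩
  obtain ⟨a, b, p, hp, hmax⟩ := Walk.exists_isTrail_forall_isTrail_length_le_length G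
  have hab : a = b := by
    by_contra hab
    obtain ⟨w, hw, hwp⟩ := hp.exists_adj_notMem_edges hab (heven b)
    have ht : (p.concat hw).reverse.IsTrail := by
      rw [Walk.reverse_concat, Walk.isTrail_cons]
      refine ⟨hp.reverse, ?_⟩
      rwa [Walk.edges_reverse, List.mem_reverse, Sym2.eq_swap]
    have := hmax _ _ _ ht
    simp at this
  subst hab
  have hadj : ∀ x ∈ p.support, ∀ y, G.Adj x y → s(x, y) ∈ p.edges := by
    intro x hx y hxy
    by_contra hn
    have ht : (Walk.cons hxy.symm (p.rotate x hx)).IsTrail := by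
      rw [Walk.isTrail_cons, (p.rotate_edges x hx).mem_iff, Sym2.eq_swap]
      exact ⟨hp.rotate hx, hn⟩
    have := hmax _ _ _ ht
    simp at this
  have hsupp : ∀ x, x ∈ p.support := by
    intro x
    by_contra hx
    obtain ⟨q⟩ := hG.preconnected a x
    obtain ⟨d, -, hd, hd'⟩ := q.exists_boundary_dart {y | y ∈ p.support} p.start_mem_support hx
    exact hd' (p.snd_mem_support_of_mem_edges (hadj _ hd _ d.adj))
  refine ⟨p.rotate v (hsupp v), (hp.rotate _).isEulerian_of_forall_mem fun e he => ?_⟩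
  rw [(p.rotate_edges v _).mem_iff]
  induction e with
  | _ x y => exact hadj x (hsupp x) y he

/-! ### The upper bound on the number of edges -/

/-- On an odd number of vertices, a vertex of a doubly Eulerian graph has even degree, and it is not
adjacent to all others, as nothing could then avoid it. -/
theorem IsDoublyEulerian.degree_le [Fintype V] [DecidableEq V] [DecidableRel G.Adj]
    (h : G.IsDoublyEulerian) (hodd : Odd (Fintype.card V)) (h1 : 1 < Fintype.card V) (w : V) :
    G.degree w ≤ Fintype.card V - 3 := by
  have := Fintype.one_lt_card_iff_nontrivial.1 h1
  obtain ⟨u, hu⟩ := exists_ne w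
  obtain ⟨p, q, hp, hq, hpq, hav⟩ := h.2 u
  have heven : Even (G.degree w) := hp.even_degree_iff.2 fun h => (h rfl).elim
  have hlt := G.degree_lt_card_verts w
  suffices hne : G.degree w ≠ Fintype.card V - 1 by
    obtain ⟨k, hk⟩ := hodd
    obtain ⟨l, hl⟩ := heven
    omega
  intro hdeg
  have hdom : ∀ y, y ≠ w → G.Adj w y := by
    have : G.neighborFinset w = Finset.univ.erase w := by
      refine Finset.eq_of_subset_of_card_le (fun y hy => ?_) ?_
      · simpa using ((G.mem_neighborFinset _ _).1 hy).ne'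
      · rw [card_neighborFinset_eq_degree, hdeg, Finset.card_erase_of_mem (Finset.mem_univ _),
          Finset.card_univ]
    intro y hy
    rw [← mem_neighborFinset, this]
    simpa using hy
  have hw : w ∈ p.support :=
    p.fst_mem_support_of_mem_edges (hp.mem_edges_iff.2 (hdom u hu))
  obtain ⟨i, rfl, hi⟩ := Walk.mem_support_iff_exists_getVert.1 hw
  have h0 : i ≠ 0 := by
    rintro rfl
    exact hu p.getVert_zero.symm
  have hl : i ≠ p.length := by
    rintro rfl
    exact hu p.getVert_length.symm
  obtain ⟨h2, h3⟩ := hav i (by omega) (by omega)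
  exact h3 (hdom _ h2.symm)

open Classical in
/-- A doubly Eulerian graph of odd order `n` that is regular of degree `n - 3` is edge-maximal. -/
theorem IsRegularOfDegree.isEdgeMaximalDoublyEulerian [Fintype V]
    (hreg : G.IsRegularOfDegree (Fintype.card V - 3)) (hG : G.IsDoublyEulerian)
    (hodd : Odd (Fintype.card V)) (h1 : 1 < Fintype.card V) :
    G.IsEdgeMaximalDoublyEulerian := by
  refine ⟨hG, fun H hH => ?_⟩
  have hsum : ∑ v, H.degree v ≤ ∑ v, G.degree v :=
    Finset.sum_le_sum fun v _ => (hH.degree_le hodd h1 v).trans (hreg v).ge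
  rw [sum_degrees_eq_twice_card_edges, sum_degrees_eq_twice_card_edges] at hsum
  omega

end SimpleGraph

/-! ### Eulerian circuits from pieces -/

namespace SimpleGraph

variable {V : Type*} {G : SimpleGraph V}

theorem Walk.IsTrail.isEulerian_of_perm [DecidableEq V] {a b c d u v : V} {W : G.Walk a b}
    (hW : W.IsTrail) {T : (G.deleteEdges {e | e ∈ W.edges}).Walk c d} (hT : T.IsEulerian)
    {p : G.Walk u v} (hp : p.edges.Perm (W.edges ++ T.edges)) : p.IsEulerian := by
  have hmem : ∀ e, e ∈ T.edges ↔ e ∈ G.edgeSet ∧ e ∉ W.edges := fun e => by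
    rw [hT.mem_edges_iff, edgeSet_deleteEdges]
    rfl
  rw [Walk.isEulerian_iff, Walk.isTrail_def, hp.nodup_iff, List.nodup_append']
  refine ⟨⟨hW.edges_nodup, hT.isTrail.edges_nodup, fun e he he' => ((hmem e).1 he').2 he⟩,
    fun e he => ?_⟩
  rw [hp.mem_iff, List.mem_append, hmem]
  tauto

theorem Walk.IsEulerian.of_perm [DecidableEq V] {a b u v : V} {p : G.Walk a b} {q : G.Walk u v}
    (hp : p.IsEulerian) (h : q.edges.Perm p.edges) : q.IsEulerian := fun e he => by
  rw [h.count_eq]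
  exact hp e he

theorem Walk.IsEulerian.map_iso [DecidableEq V] {u v : V} {p : G.Walk u v} (hp : p.IsEulerian)
    (f : G ≃g G) : (p.map f.toHom).IsEulerian := by
  rw [Walk.isEulerian_iff, Walk.isTrail_map_iff_of_injective f.injective]
  refine ⟨hp.isTrail, fun e he => ?_⟩
  rw [Walk.edges_map, List.mem_map]
  induction e with
  | _ x y =>
    refine ⟨s(f.symm x, f.symm y), hp.mem_edges_iff.2 (f.symm.map_adj_iff.2 he), ?_⟩
    simp

/-- Two walks of the same length stay apart if at every step, the first and the last included, their
current vertices are neither equal nor adjacent. -/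
def Walk.StaysApart {a b c d : V} (p : G.Walk a b) (q : G.Walk c d) : Prop :=
  p.length = q.length ∧
    ∀ i : ℕ, p.getVert i ≠ q.getVert i ∧ ¬ G.Adj (p.getVert i) (q.getVert i)

theorem Walk.StaysApart.nil {a b : V} (h : a ≠ b) (h' : ¬ G.Adj a b) :
    (Walk.nil : G.Walk a a).StaysApart (Walk.nil : G.Walk b b) :=
  ⟨rfl, fun _ => ⟨h, h'⟩⟩

theorem Walk.StaysApart.append {a b c d x y : V} {p : G.Walk a b} {q : G.Walk c d}
    {p' : G.Walk b x} {q' : G.Walk d y} (h : p.StaysApart q) (h' : p'.StaysApart q') :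
    (p.append p').StaysApart (q.append q') := by
  refine ⟨by rw [Walk.length_append, Walk.length_append, h.1, h'.1], fun i => ?_⟩
  rw [Walk.getVert_append, Walk.getVert_append, h.1]
  split_ifs
  · exact h.2 i
  · exact h'.2 _

theorem Walk.StaysApart.cons {a b c d x y : V} {p : G.Walk a b} {q : G.Walk c d}
    (hx : G.Adj x a) (hy : G.Adj y c) (h : p.StaysApart q) (hne : x ≠ y) (hna : ¬ G.Adj x y) :
    (Walk.cons hx p).StaysApart (Walk.cons hy q) := by
  refine ⟨by rw [Walk.length_cons, Walk.length_cons, h.1], fun i => ?_⟩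
  cases i with
  | zero => exact ⟨hne, hna⟩
  | succ i => exact h.2 i

theorem Walk.StaysApart.isAvoiding {a b c d u : V} {p : G.Walk a b} {q : G.Walk c d}
    (h : p.StaysApart q) (ha : G.Adj u a) (hb : G.Adj b u) (hc : G.Adj u c) (hd : G.Adj d u) :
    (Walk.cons ha (p.concat hb)).IsAvoiding (Walk.cons hc (q.concat hd)) := by
  refine ⟨by simp [h.1], fun i hi hi' => ?_⟩
  obtain ⟨j, rfl⟩ : ∃ j, i = j + 1 := ⟨i - 1, by omega⟩
  rw [Walk.length_cons, Walk.length_concat] at hi'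
  rw [Walk.getVert_cons_succ, Walk.getVert_cons_succ, Walk.concat_eq_append,
    Walk.concat_eq_append, Walk.getVert_append', Walk.getVert_append', ← h.1,
    if_pos (by omega), if_pos (by omega)]
  exact h.2 j

theorem Walk.IsAvoiding.map_iso {u : V} {p q : G.Walk u u} (h : p.IsAvoiding q) (f : G ≃g G) :
    (p.map f.toHom).IsAvoiding (q.map f.toHom) := by
  refine ⟨by simpa using h.1, fun i hi hi' => ?_⟩
  rw [Walk.length_map] at hi'
  rw [Walk.getVert_map, Walk.getVert_map]
  exact ⟨fun he => (h.2 i hi hi').1 (f.injective he),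
    fun ha => (h.2 i hi hi').2 (f.map_adj_iff.1 ha)⟩

/-! ### The complement of an odd cycle -/

/-- The jumps other than `0` and `±1`. The circulant graph with these jumps is the complement of
the cycle on `ZMod n`. -/
def coCycleJumps (n : ℕ) [NeZero n] : Finset (ZMod n) := Finset.univ \ {0, 1, -1}

/-- The complement of the cycle on `ZMod n`, as a circulant graph. -/
abbrev coCycle (n : ℕ) [NeZero n] : SimpleGraph (ZMod n) :=
  circulantGraph (coCycleJumps n : Set (ZMod n))

theorem coCycle_adj {n : ℕ} [NeZero n] {x y : ZMod n} :
    (coCycle n).Adj x y ↔ x ≠ y ∧ x ≠ y + 1 ∧ y ≠ x + 1 := by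
  simp only [coCycle, circulantGraph_adj, coCycleJumps, Finset.coe_sdiff, Finset.coe_univ,
    Finset.coe_insert, Finset.coe_singleton, Set.mem_sdiff, Set.mem_univ, true_and,
    Set.mem_insert_iff, Set.mem_singleton_iff, not_or, sub_eq_iff_eq_add, zero_add]
  have h1 : x = 1 + y ↔ x = y + 1 := by rw [add_comm]
  have h2 : y = 1 + x ↔ y = x + 1 := by rw [add_comm]
  have h3 : x = -1 + y ↔ y = x + 1 := by
    rw [eq_neg_add_iff_add_eq, add_comm, eq_comm]
  have h4 : y = -1 + x ↔ x = y + 1 := by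
    rw [eq_neg_add_iff_add_eq, add_comm, eq_comm]
  rw [h1, h2, h3, h4, eq_comm (a := y) (b := x)]
  tauto

theorem coCycle_not_adj_add_one {n : ℕ} [NeZero n] (x : ZMod n) : ¬ (coCycle n).Adj x (x + 1) :=
  fun h => (coCycle_adj.1 h).2.2 rfl

theorem coCycle_adj_natCast {n : ℕ} [NeZero n] {a b : ℕ} (h : a + 2 ≤ b) (h' : b + 2 ≤ a + n) :
    (coCycle n).Adj a b := by
  obtain ⟨d, rfl⟩ : ∃ d, b = a + (d + 2) := ⟨b - a - 2, by omega⟩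
  have hz : ∀ m : ℕ, 0 < m → m < n → (m : ZMod n) ≠ 0 := fun m hm hmn h0 =>
    absurd (Nat.le_of_dvd hm ((ZMod.natCast_eq_zero_iff m n).1 h0)) (by omega)
  rw [coCycle_adj]
  refine ⟨fun h => hz (d + 2) (by omega) (by omega) ?_,
    fun h => hz (d + 3) (by omega) (by omega) ?_, fun h => hz (d + 1) (by omega) (by omega) ?_⟩
  · push_cast at h ⊢; linear_combination -h
  · push_cast at h ⊢; linear_combination -h
  · push_cast at h ⊢; linear_combination h

theorem coCycle_isRegularOfDegree {n : ℕ} [NeZero n] (hn : 3 ≤ n)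
    [(coCycle n).LocallyFinite] : (coCycle n).IsRegularOfDegree (n - 3) := by
  intro x
  have hz : ∀ m : ℕ, 0 < m → m < n → (m : ZMod n) ≠ 0 := fun m hm hmn h0 =>
    absurd (Nat.le_of_dvd hm ((ZMod.natCast_eq_zero_iff m n).1 h0)) (by omega)
  have h1 : (1 : ZMod n) ≠ 0 := by exact_mod_cast hz 1 (by omega) (by omega)
  have h2 : (2 : ZMod n) ≠ 0 := by exact_mod_cast hz 2 (by omega) (by omega)
  have hN : (coCycle n).neighborFinset x = Finset.univ \ {x, x + 1, x - 1} := by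
    ext y
    rw [mem_neighborFinset, coCycle_adj]
    simp only [Finset.mem_sdiff, Finset.mem_univ, true_and, Finset.mem_insert,
      Finset.mem_singleton, not_or, eq_sub_iff_add_eq]
    grind
  rw [← card_neighborFinset_eq_degree, hN, Finset.card_sdiff_of_subset (Finset.subset_univ _),
    Finset.card_univ, ZMod.card, Finset.card_eq_three.2 ⟨x, x + 1, x - 1, ?_, ?_, ?_, rfl⟩]
  · exact fun h => h1 (by linear_combination -h)
  · exact fun h => h1 (by linear_combination h)
  · exact fun h => h2 (by linear_combination h)

/-- Translation by `c`, as an automorphism of the complement of a cycle. -/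
def coCycleTranslate (n : ℕ) [NeZero n] (c : ZMod n) : coCycle n ≃g coCycle n where
  toEquiv := Equiv.addRight c
  map_rel_iff' := circulantGraph_adj_translate

theorem coCycleTranslate_apply {n : ℕ} [NeZero n] (c x : ZMod n) :
    (coCycleTranslate n c).toHom x = x + c := rfl

end SimpleGraph

/-! ### Two avoiding Eulerian circuits in the complement of an odd cycle -/

namespace SimpleGraph

variable {n : ℕ} [NeZero n]

/-- The walk `a, a + 2, …, a + 2 * j` in the complement of a cycle. Its vertices are natural numbers
cast to `ZMod n`, and may pass `n`. -/
def strideTwo (hn : 4 ≤ n) (a : ℕ) : (j : ℕ) → (coCycle n).Walk (a : ZMod n) ((a + 2 * j : ℕ))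
  | 0 => Walk.nil
  | j + 1 => (strideTwo hn a j).append
      (Walk.cons (coCycle_adj_natCast (by omega) (by omega)) Walk.nil)

theorem strideTwo_edges (hn : 4 ≤ n) (a j : ℕ) :
    (strideTwo hn a j).edges = (List.range j).map fun i =>
      s(((a + 2 * i : ℕ) : ZMod n), ((a + 2 * (i + 1) : ℕ) : ZMod n)) := by
  induction j with
  | zero => rfl
  | succ j ih =>
    rw [strideTwo, Walk.edges_append, ih, List.range_succ, List.map_append]
    rfl

/-- Both sides list the edges of the walk `a, a + 2, …, a + 2 * (j + 1)`. -/
theorem strideTwo_edges_shift (hn : 4 ≤ n) (a j : ℕ) :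
    (strideTwo hn a j).edges ++ [s(((a + 2 * j : ℕ) : ZMod n), ((a + 2 + 2 * j : ℕ) : ZMod n))] =
      s((a : ZMod n), ((a + 2 : ℕ) : ZMod n)) :: (strideTwo hn (a + 2) j).edges := by
  have h := strideTwo_edges hn a (j + 1)
  rw [List.range_succ_eq_map, List.map_cons, List.map_map] at h
  rw [strideTwo, Walk.edges_append] at h
  rw [strideTwo_edges hn (a + 2)]
  convert h using 2
  · simp only [Walk.edges_cons, Walk.edges_nil]
    rw [show a + 2 + 2 * j = a + 2 * j + 2 by ring]
    rfl
  · rfl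
  · refine List.map_congr_left fun i _ => ?_
    simp only [Function.comp, Nat.succ_eq_add_one]
    rw [show a + 2 + 2 * i = a + 2 * (i + 1) by ring,
      show a + 2 + 2 * (i + 1) = a + 2 * (i + 1 + 1) by ring]

theorem strideTwo_edges_map_add_one (hn : 4 ≤ n) (a j : ℕ) :
    (strideTwo hn a j).edges.map (Sym2.map (· + 1)) = (strideTwo hn (a + 1) j).edges := by
  rw [strideTwo_edges, strideTwo_edges, List.map_map]
  refine List.map_congr_left fun i _ => ?_
  simp only [Function.comp, Sym2.map_mk]
  congr 2 <;> push_cast <;> ring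

theorem coCycle_not_adj_add_one' (x : ZMod n) : ¬ (coCycle n).Adj (x + 1) x :=
  fun h => coCycle_not_adj_add_one x h.symm

theorem zmod_ne_add_one {n : ℕ} (hn : 2 ≤ n) (x : ZMod n) : x ≠ x + 1 := by
  have : Fact (1 < n) := ⟨hn⟩
  simp

theorem strideTwo_staysApart (hn : 4 ≤ n) (a j : ℕ) :
    (strideTwo hn (a + 1) j).StaysApart (strideTwo hn a j) := by
  have hne : ∀ b : ℕ, ((b + 1 : ℕ) : ZMod n) ≠ b ∧ ¬ (coCycle n).Adj ((b + 1 : ℕ) : ZMod n) b := by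
    intro b
    rw [Nat.cast_succ]
    exact ⟨(zmod_ne_add_one (by omega) _).symm, coCycle_not_adj_add_one' _⟩
  induction j with
  | zero => exact .nil (hne a).1 (hne a).2
  | succ j ih =>
    have h1 := hne (a + 2 * j)
    have h2 := hne (a + 2 * (j + 1))
    rw [show a + 2 * j + 1 = a + 1 + 2 * j by ring] at h1
    rw [show a + 2 * (j + 1) + 1 = a + 1 + 2 * (j + 1) by ring] at h2
    exact ih.append (.cons _ _ (.nil h2.1 h2.2) h1.1 h1.2)

/-- A walk translated by one stays apart from the original walk. -/
theorem exists_staysApart_translate (hn : 2 ≤ n) {a b : ZMod n} (hab : (coCycleTranslate n 1).toHom a = b)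
    (T : (coCycle n).Walk a a) :
    ∃ T' : (coCycle n).Walk b b, T'.edges = T.edges.map (Sym2.map (· + 1)) ∧ T.StaysApart T' := by
  subst hab
  refine ⟨T.map (coCycleTranslate n 1).toHom, Walk.edges_map _ _,
    (Walk.length_map _ _).symm, fun i => ?_⟩
  rw [Walk.getVert_map, coCycleTranslate_apply]
  exact ⟨zmod_ne_add_one hn _, coCycle_not_adj_add_one _⟩

variable (k : ℕ)

/-- The closed walk `0, -3, 2, 4, …, -1, 2, 0` in the complement of the cycle on `ZMod (2 * k + 3)`.
Here `-3` is written as `2 * k`, and `-1` as `2 + 2 * k`. -/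
def evenTour (hk : 3 ≤ k) : (coCycle (2 * k + 3)).Walk ((0 : ℕ) : ZMod (2 * k + 3)) ((0 : ℕ)) :=
  Walk.cons (v := ((2 * k : ℕ) : ZMod (2 * k + 3))) (coCycle_adj_natCast (by omega) (by omega)) <|
  Walk.cons (v := ((2 : ℕ) : ZMod (2 * k + 3))) (coCycle_adj_natCast (by omega) (by omega)).symm <|
  (strideTwo (by omega) 2 k).append <|
  Walk.cons (v := ((2 : ℕ) : ZMod (2 * k + 3))) (coCycle_adj_natCast (by omega) (by omega)).symm <|
  Walk.cons (coCycle_adj_natCast (by omega) (by omega)).symm Walk.nil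

theorem evenTour_edges_map_val (hk : 3 ≤ k) :
    (evenTour k hk).edges.map (Sym2.map ZMod.val) =
      s(0, 2 * k) :: s(2 * k, 2) :: ((List.range k).map (fun i => s(2 + 2 * i, 2 + 2 * (i + 1))) ++
        [s(2 + 2 * k, 2), s(2, 0)]) := by
  have hval : ∀ m : ℕ, m < 2 * k + 3 → (m : ZMod (2 * k + 3)).val = m := fun m hm =>
    ZMod.val_natCast_of_lt hm
  simp only [evenTour, Walk.edges_cons, Walk.edges_append, strideTwo_edges, Walk.edges_nil,
    List.map_cons, List.map_append, List.map_map, List.map_nil, Sym2.map_mk]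
  rw [hval 0 (by omega), hval 2 (by omega), hval (2 * k) (by omega), hval (2 + 2 * k) (by omega)]
  congr 3
  refine List.map_congr_left fun i hi => ?_
  rw [List.mem_range] at hi
  simp only [Function.comp, Sym2.map_mk]
  rw [hval _ (by omega), hval _ (by omega)]

theorem evenTour_isTrail (hk : 3 ≤ k) : (evenTour k hk).IsTrail := by
  rw [Walk.isTrail_def]
  apply List.Nodup.of_map (Sym2.map ZMod.val)
  rw [evenTour_edges_map_val]
  have hr : ((List.range k).map fun i => s(2 + 2 * i, 2 + 2 * (i + 1))).Nodup := by
    refine List.nodup_range.map fun i j h => ?_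
    simp only [Sym2.eq_iff] at h
    omega
  simp only [List.nodup_cons, List.nodup_append', hr, List.mem_cons, List.mem_append,
    List.mem_map, List.mem_range, List.not_mem_nil, Sym2.eq_iff, not_or, not_exists, not_and,
    List.disjoint_left, List.nodup_nil, forall_exists_index, and_imp, or_false, true_and]
  refine ⟨⟨by omega, by omega, by omega, by omega⟩, ⟨by omega, by omega⟩, ?_⟩
  refine ⟨⟨by omega, not_false, trivial⟩, ?_⟩
  rintro _ i hi rfl
  simp only [Sym2.eq_iff]
  omega

/-- The tour uses no edge at a vertex with an odd representative. -/
theorem even_val_of_mem_evenTour (hk : 3 ≤ k) {e : Sym2 (ZMod (2 * k + 3))}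
    (he : e ∈ (evenTour k hk).edges) {x : ZMod (2 * k + 3)} (hx : x ∈ e) : Even x.val := by
  have h1 : e.map ZMod.val ∈ (evenTour k hk).edges.map (Sym2.map ZMod.val) :=
    List.mem_map_of_mem he
  have h2 : x.val ∈ e.map ZMod.val := Sym2.mem_map.2 ⟨x, hx, rfl⟩
  rw [evenTour_edges_map_val] at h1
  simp only [List.mem_cons, List.mem_append, List.mem_map, List.mem_range,
    List.not_mem_nil, or_false] at h1
  rw [even_iff_two_dvd]
  rcases h1 with h | h | ⟨i, -, h⟩ | h | h <;> [skip; skip; symm at h; skip; skip] <;>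
    rw [h, Sym2.mem_iff] at h2 <;> omega

/-- Without the edges of the tour, all vertices are still joined to `1` over odd vertices. -/
theorem deleteEdges_evenTour_connected (hk : 3 ≤ k) :
    ((coCycle (2 * k + 3)).deleteEdges {e | e ∈ (evenTour k hk).edges}).Connected := by
  have hadj : ∀ a b : ℕ, a < 2 * k + 3 → Odd a → (coCycle (2 * k + 3)).Adj a b →
      ((coCycle (2 * k + 3)).deleteEdges {e | e ∈ (evenTour k hk).edges}).Adj a b := by
    intro a b ha hao hab
    rw [deleteEdges_adj]
    refine ⟨hab, fun he => ?_⟩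
    have := even_val_of_mem_evenTour k hk he (Sym2.mem_mk_left _ _)
    rw [ZMod.val_natCast_of_lt ha] at this
    exact Nat.not_even_iff_odd.2 hao this
  have key : ∀ m : ℕ, m < 2 * k + 3 →
      ((coCycle (2 * k + 3)).deleteEdges {e | e ∈ (evenTour k hk).edges}).Reachable
        ((1 : ℕ) : ZMod (2 * k + 3)) m := by
    intro m hm
    have h3 : ∀ m : ℕ, 3 ≤ m → m < 2 * k + 3 →
      ((coCycle (2 * k + 3)).deleteEdges {e | e ∈ (evenTour k hk).edges}).Reachable
        ((1 : ℕ) : ZMod (2 * k + 3)) m := fun m h3 hm =>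
      (hadj 1 m (by omega) (by decide) (coCycle_adj_natCast (by omega) (by omega))).reachable
    rcases (by omega : m = 0 ∨ m = 1 ∨ m = 2 ∨ 3 ≤ m) with rfl | rfl | rfl | h
    · exact (h3 3 le_rfl (by omega)).trans (hadj 3 0 (by omega) (by decide)
        (coCycle_adj_natCast (by omega) (by omega)).symm).reachable
    · exact Reachable.refl _
    · exact (h3 5 (by omega) (by omega)).trans (hadj 5 2 (by omega) (by decide)
        (coCycle_adj_natCast (by omega) (by omega)).symm).reachable
    · exact h3 m h hm
  have hone : ∀ x, ((coCycle (2 * k + 3)).deleteEdges {e | e ∈ (evenTour k hk).edges}).Reachable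
        ((1 : ℕ) : ZMod (2 * k + 3)) x := fun x => by
    have := key x.val x.val_lt
    rwa [ZMod.natCast_zmod_val] at this
  exact { preconnected := fun x y => (hone x).symm.trans (hone y), nonempty := ⟨0⟩ }

/-- With `T` an Eulerian circuit from `2` of what the tour leaves, and `T + 1` its translate, the
circuits are `0, -3, 2, 4, …, -1, T, 0` and `0, -2, 1, 3, …, -2, T + 1, 0`. -/
theorem exists_avoiding_isEulerian_coCycle (hk : 3 ≤ k) :
    ∃ p q : (coCycle (2 * k + 3)).Walk ((0 : ℕ) : ZMod (2 * k + 3)) ((0 : ℕ)),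
      p.IsEulerian ∧ q.IsEulerian ∧ p.IsAvoiding q := by
  classical
  obtain ⟨T, hT⟩ := (deleteEdges_evenTour_connected k hk).exists_isEulerian (fun x =>
    (evenTour_isTrail k hk).even_degree_deleteEdges (by
      rw [coCycle_isRegularOfDegree (by omega) x]
      exact ⟨k, by omega⟩)) ((2 : ℕ) : ZMod (2 * k + 3))
  set G := coCycle (2 * k + 3)
  let T₀ : G.Walk ((2 : ℕ) : ZMod (2 * k + 3)) ((2 : ℕ)) := T.mapLe (deleteEdges_le _)
  have hT₀ : T₀.edges = T.edges := Walk.edges_mapLe_eq_edges ..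
  have h3 : ((2 : ℕ) : ZMod (2 * k + 3)) + 1 = ((3 : ℕ)) := by push_cast; ring
  obtain ⟨T₁, hT₁, hTT⟩ := exists_staysApart_translate (by omega) h3 T₀
  have a1 : G.Adj ((0 : ℕ) : ZMod (2 * k + 3)) ((2 * k : ℕ)) :=
    coCycle_adj_natCast (by omega) (by omega)
  have a2 : G.Adj ((2 * k : ℕ) : ZMod (2 * k + 3)) ((2 : ℕ)) :=
    (coCycle_adj_natCast (by omega) (by omega)).symm
  have a3 : G.Adj ((2 + 2 * k : ℕ) : ZMod (2 * k + 3)) ((2 : ℕ)) :=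
    (coCycle_adj_natCast (by omega) (by omega)).symm
  have a4 : G.Adj ((2 : ℕ) : ZMod (2 * k + 3)) ((0 : ℕ)) :=
    (coCycle_adj_natCast (by omega) (by omega)).symm
  have b1 : G.Adj ((0 : ℕ) : ZMod (2 * k + 3)) ((2 * k + 1 : ℕ)) :=
    coCycle_adj_natCast (by omega) (by omega)
  have b2 : G.Adj ((2 * k + 1 : ℕ) : ZMod (2 * k + 3)) ((1 : ℕ)) :=
    (coCycle_adj_natCast (by omega) (by omega)).symm
  have b3 : G.Adj ((1 + 2 * k : ℕ) : ZMod (2 * k + 3)) ((3 : ℕ)) :=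
    (coCycle_adj_natCast (by omega) (by omega)).symm
  have b4 : G.Adj ((3 : ℕ) : ZMod (2 * k + 3)) ((0 : ℕ)) :=
    (coCycle_adj_natCast (by omega) (by omega)).symm
  have hn : 4 ≤ 2 * k + 3 := by omega
  have hapart : ∀ m : ℕ, (m : ZMod (2 * k + 3)) ≠ ((m + 1 : ℕ)) ∧
      ¬ G.Adj (m : ZMod (2 * k + 3)) ((m + 1 : ℕ)) := fun m => by
    rw [Nat.cast_succ]
    exact ⟨zmod_ne_add_one (by omega) _, coCycle_not_adj_add_one _⟩
  have hmid : (Walk.cons a2 ((strideTwo hn 2 k).append (Walk.cons a3 T₀))).StaysApart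
      (Walk.cons b2 ((strideTwo hn 1 k).append (Walk.cons b3 T₁))) := by
    have h := hapart (1 + 2 * k)
    rw [show 1 + 2 * k + 1 = 2 + 2 * k by ring] at h
    exact ((strideTwo_staysApart hn 1 k).append
      (hTT.cons a3 b3 h.1.symm fun h' => h.2 h'.symm)).cons a2 b2 (hapart _).1 (hapart _).2
  have hp : (Walk.cons a1 ((Walk.cons a2
      ((strideTwo hn 2 k).append (Walk.cons a3 T₀))).concat a4)).IsEulerian := by
    refine (evenTour_isTrail k hk).isEulerian_of_perm hT ?_
    rw [← hT₀, List.perm_iff_count]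
    intro e
    simp only [evenTour, Walk.edges_cons, Walk.edges_append, Walk.edges_concat, Walk.edges_nil,
      List.concat_eq_append, List.count_append, List.count_cons, List.count_nil]
    omega
  refine ⟨_, _, hp, ?_, hmid.isAvoiding a1 a4 b1 b4⟩
  refine (hp.map_iso (coCycleTranslate _ 1)).of_perm ?_
  have c0 : ((0 : ℕ) : ZMod (2 * k + 3)) + 1 = ((1 : ℕ)) := by push_cast; ring
  have c1 : ((2 * k : ℕ) : ZMod (2 * k + 3)) + 1 = ((2 * k + 1 : ℕ)) := by push_cast; ring
  have c2 : ((2 + 2 * k : ℕ) : ZMod (2 * k + 3)) + 1 = ((0 : ℕ)) := by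
    have := ZMod.natCast_self (2 * k + 3)
    push_cast at this ⊢
    linear_combination this
  have c3 : ((1 + 2 + 2 * k : ℕ) : ZMod (2 * k + 3)) = ((0 : ℕ)) := by
    rw [← c2]
    push_cast
    ring
  -- The strides of the two circuits differ by the edges `{-2, 0}` and `{1, 3}`, which are traversed
  -- elsewhere in the other circuit.
  have hs : (strideTwo hn 1 k).edges ++ [s(((1 + 2 * k : ℕ) : ZMod (2 * k + 3)), ((0 : ℕ)))] =
      s(((1 : ℕ) : ZMod (2 * k + 3)), ((3 : ℕ))) :: (strideTwo hn (2 + 1) k).edges := by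
    rw [← c3]
    exact strideTwo_edges_shift hn 1 k
  have c4 : ((1 + 2 * k : ℕ) : ZMod (2 * k + 3)) = ((2 * k + 1 : ℕ)) :=
    congrArg _ (add_comm _ _)
  rw [Walk.edges_map, List.perm_iff_count]
  intro e
  replace hs := congrArg (List.count e) hs
  change _ = List.count e (List.map (Sym2.map (· + 1)) _)
  simp only [Walk.edges_cons, Walk.edges_append, Walk.edges_concat, List.map_cons, List.map_append,
    List.concat_eq_append, strideTwo_edges_map_add_one, ← hT₁, Sym2.map_mk, c0, c1, c2, h3,
    List.count_append, List.count_cons, List.count_nil, List.map_nil] at hs ⊢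
  simp only [c4] at hs ⊢
  rw [Sym2.eq_swap (a := ((2 * k + 1 : ℕ) : ZMod (2 * k + 3))) (b := ((1 : ℕ))),
    Sym2.eq_swap (a := ((3 : ℕ) : ZMod (2 * k + 3))) (b := ((0 : ℕ))),
    Sym2.eq_swap (a := ((3 : ℕ) : ZMod (2 * k + 3))) (b := ((1 : ℕ))),
    Sym2.eq_swap (a := ((0 : ℕ) : ZMod (2 * k + 3))) (b := ((2 * k + 1 : ℕ)))]
  omega

end SimpleGraph

theorem mainTheorem1 (n : ℕ) [NeZero n] (hodd : Odd n) (hn : 9 ≤ n) :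
    ∃ S : Finset (ZMod n),
      (SimpleGraph.circulantGraph (S : Set (ZMod n))).IsEdgeMaximalDoublyEulerian ∧
      (SimpleGraph.circulantGraph (S : Set (ZMod n))).IsRegularOfDegree (n - 3) := by
  classical
  obtain ⟨k, rfl⟩ : ∃ k, n = 2 * k + 3 := by
    obtain ⟨l, rfl⟩ := hodd
    exact ⟨l - 1, by omega⟩
  have hreg := SimpleGraph.coCycle_isRegularOfDegree (n := 2 * k + 3) (by omega)
  refine ⟨SimpleGraph.coCycleJumps (2 * k + 3), ?_,
    SimpleGraph.coCycle_isRegularOfDegree (by omega)⟩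
  refine SimpleGraph.IsRegularOfDegree.isEdgeMaximalDoublyEulerian
    (by convert hreg; exact ZMod.card _) ⟨?_, fun u => ?_⟩ (by rwa [ZMod.card])
    (by rw [ZMod.card]; omega)
  · exact (SimpleGraph.deleteEdges_evenTour_connected k (by omega)).mono
      (SimpleGraph.deleteEdges_le _)
  · obtain ⟨p, q, hp, hq, hpq⟩ := SimpleGraph.exists_avoiding_isEulerian_coCycle k (by omega)
    have hu : (SimpleGraph.coCycleTranslate (2 * k + 3) u).toHom ((0 : ℕ)) = u := by
      rw [SimpleGraph.coCycleTranslate_apply, Nat.cast_zero, zero_add]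
    suffices h : ∀ v, (SimpleGraph.coCycleTranslate (2 * k + 3) u).toHom ((0 : ℕ)) = v →
        ∃ p q : (SimpleGraph.coCycle (2 * k + 3)).Walk v v,
          p.IsEulerian ∧ q.IsEulerian ∧ p.IsAvoiding q by
      obtain ⟨p, q, hp, hq, hpq⟩ := h u hu
      exact ⟨p, q, by convert hp, by convert hq, hpq⟩
    rintro _ rfl
    exact ⟨p.map _, q.map _, hp.map_iso _, hq.map_iso _, hpq.map_iso _⟩
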